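/- Let $S \subseteq\, ]0,+\infty[$ and let $\mathcal{U}_S$ be the class of all finite ultrametric spaces whose distances between distinct points lie in $S$. For metric spaces $X, Z$, let $\binom{Z}{X}$ be the set of subspaces of $Z$ isometric to $X$, and for integers $k, l \ge 1$ write $Z \to (Y)^X_{k,l}$ if for every map $\chi : \binom{Z}{X} \to \{1,\dots,k\}$ there is $\widetilde{Y} \in \binom{Z}{Y}$ such that $\chi$ takes at most $l$ values on $\binom{\widetilde{Y}}{X}$. The Ramsey degree of $X \in \mathcal{U}_S$ in $\mathcal{U}_S$ is, if it exists, the least integer $l \ge 1$ such that for every $Y \in \mathcal{U}_S$ and every $k \ge 1$ there is $Z \in \mathcal{U}_S$ with $Z \to (Y)^X_{k,l}$. Let $\mathrm{iso}(X)$ be the set of isometries of $X$ onto itself and $\mathrm{cLO}(X)$ the set of convex linear orderings of $X$, i.e. linear orderings for which every metric ball of $X$ is convex. Two orderings in $\mathrm{cLO}(X)$ have the same order type if some isometry of $X$ onto itself carries one to the other. Theorem. Every $X \in \mathcal{U}_S$ has a Ramsey degree in $\mathcal{U}_S$. It is equal to $|\mathrm{cLO}(X)|/|\mathrm{iso}(X)|$,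 and this is the number of order types of convex linear orderings on $X$. -/

import Mathlib

universe u

namespace UltraRamsey

/-- The class of all finite ultrametric spaces with distances in `S`: the distance between any
two distinct points belongs to `S`. -/
def FinUltrametric (S : Set ℝ) (X : Type u) (_ : MetricSpace X) : Prop :=
  Finite X ∧ IsUltrametricDist X ∧ ∀ x y : X, x ≠ y → dist x y ∈ S

/-- The set of all subspaces of `Z` which are isometric to `X` (the copies of `X` in `Z`). -/
def copies (X Z : Type u) [MetricSpace X] [MetricSpace Z] : Set (Set Z) :=
  {A | Nonempty (A ≃ᵢ X)}

/-- The arrow relation `Z ⟶ (Y)^X_{k,l}`: for every colouring `χ` of the copies of `X` in `Z` with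
`k` colours there is a copy `B` of `Y` in `Z` such that `χ` takes at most `l` values on the copies
of `X` contained in `B`. -/
def Arrows (X Y Z : Type u) [MetricSpace X] [MetricSpace Y] [MetricSpace Z] (k l : ℕ) : Prop :=
  ∀ χ : copies X Z → Fin k, ∃ B ∈ copies Y Z,
    (χ '' {A : copies X Z | (A : Set Z) ⊆ B}).ncard ≤ l

/-- `X` has a Ramsey degree in the class `K`, and it is equal to `t`: `t` is the least positive
integer `l` such that for every `Y` in `K` and every `k ≥ 1` there is `Z` in `K` with
`Z ⟶ (Y)^X_{k,l}`. -/
def IsRamseyDegree (K : (Y : Type u) → MetricSpace Y → Prop) (X : Type u) [MetricSpace X]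
    (t : ℕ) : Prop :=
  IsLeast {l : ℕ | 0 < l ∧ ∀ (Y : Type u) (_ : MetricSpace Y), K Y inferInstance →
    ∀ k : ℕ, 0 < k → ∃ (Z : Type u) (_ : MetricSpace Z), K Z inferInstance ∧ Arrows X Y Z k l} t

/-- `B` is convex for the strict ordering `r`. -/
def IsConvexFor {X : Type u} (r : X → X → Prop) (B : Set X) : Prop :=
  ∀ x ∈ B, ∀ z ∈ B, ∀ y, r x y → r y z → y ∈ B

/-- The set of convex (strict) linear orderings of `X`: all metric balls, open and closed, are
convex for the ordering. -/
def cLO (X : Type u) [MetricSpace X] : Set (X → X → Prop) :=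
  {r | IsStrictTotalOrder X r ∧ ∀ (c : X) (ε : ℝ),
    IsConvexFor r (Metric.ball c ε) ∧ IsConvexFor r (Metric.closedBall c ε)}

/-- Two convex linear orderings of `X` have the same order type when the corresponding ordered
metric spaces are isomorphic, i.e. there is an order preserving isometry between them. -/
def orderTypeSetoid (X : Type u) [MetricSpace X] : Setoid (cLO X) where
  r r₁ r₂ := ∃ e : X ≃ᵢ X, ∀ x y, r₁.1 x y ↔ r₂.1 (e x) (e y)
  iseqv :=
    { refl := fun _ => ⟨IsometryEquiv.refl X, fun _ _ => Iff.rfl⟩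
      symm := fun {_ _} ⟨e, h⟩ => ⟨e.symm, fun x y => by
        rw [h, e.apply_symm_apply, e.apply_symm_apply]⟩
      trans := fun {_ _ _} ⟨e, h⟩ ⟨f, g⟩ => ⟨e.trans f, fun x y => by
        rw [h, g]; rfl⟩ }

/-- The order types of convex linear orderings of `X`. -/
abbrev OrderTypes (X : Type u) [MetricSpace X] : Type u := Quotient (orderTypeSetoid X)

end UltraRamsey

/-! A finite ultrametric space is the set of leaves of a tree of balls, and a convex ordering is a
left-to-right drawing of that tree. Isometries of `X` act freely on `cLO X`, because a finite linear
order has no nontrivial automorphism. The orbits are the order types, whence the quotient formula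
(`card_cLO_eq`).

Lower bound: a convex ordering of `Z` colours each copy of `X` by the order type it inherits. Let
`Y` be a regular tree with enough branching. Up to isometry each of its convex orderings is
lexicographic, so all types of `X` occur in it (`Leaves.exists_isometry_pullback_eq`), and every
copy of `Y` sees every colour.

Upper bound: label the balls of a convexly ordered space in depth-first order. The labels are the
coordinates of an embedding into a regular tree, and for a fixed ordering their set determines the
labelling (`IsLabelling.eq_of_range_eq`). Copies of `X` so labelled are thus encoded by sets of `q`
labels, with one `q` for all orderings. The finite Ramsey theorem gives a set `H` of labels on which
the colour depends on the type alone, and `Y` is embedded with labels in `H`. -/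

namespace UltraRamsey

/-! ### The finite Ramsey theorem -/

open Finset in
/-- The finite Ramsey theorem for hypergraphs, for colourings of the `q`-element subsets of a
finite linear order. -/
theorem exists_homogeneous_finset {κ : Type*} [Finite κ] (q m : ℕ) :
    ∃ N : ℕ, ∀ (α : Type u) [LinearOrder α] (A : Finset α), N ≤ #A → ∀ c : Finset α → κ,
      ∃ H ⊆ A, #H = m ∧ ∃ a, ∀ U ⊆ H, #U = q → c U = a := by
  classical
  induction q generalizing m with
  | zero =>
    refine ⟨m, fun α _ A hA c => ?_⟩
    obtain ⟨H, hHA, hH⟩ := exists_subset_card_eq hA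
    exact ⟨H, hHA, hH, c ∅, fun U _ hU => by rw [card_eq_zero.1 hU]⟩
  | succ q ih =>
    -- Erdős–Rado: first make the colour of a `(q+1)`-set depend only on its least element, then
    -- apply the pigeonhole principle to least elements.
    have minHom : ∀ j : ℕ, ∃ N : ℕ, ∀ (α : Type u) [LinearOrder α] (A : Finset α), N ≤ #A →
        ∀ c : Finset α → κ, ∃ H ⊆ A, #H = j ∧ ∃ f : α → κ, ∀ x ∈ H, ∀ U ⊆ H,
          (∀ y ∈ U, x < y) → #U = q → c (insert x U) = f x := by
      intro j
      induction j with
      | zero => exact ⟨0, fun α _ A _ c => ⟨∅, empty_subset _, rfl, fun _ => c ∅, by simp⟩⟩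
      | succ j ihj =>
        obtain ⟨N₁, hN₁⟩ := ihj
        obtain ⟨N₂, hN₂⟩ := ih N₁
        refine ⟨N₂ + 1, fun α _ A hA c => ?_⟩
        have hne : A.Nonempty := card_pos.1 (by omega)
        set a := A.min' hne
        have haA : a ∈ A := A.min'_mem hne
        obtain ⟨H₂, hH₂, hc₂, b, hb⟩ := hN₂ α (A.erase a)
          (by rw [card_erase_of_mem haA]; omega) (fun U => c (insert a U))
        obtain ⟨H₁, hH₁, hc₁, f, hf⟩ := hN₁ α H₂ hc₂.ge c
        have hlt : ∀ y ∈ H₁, a < y := fun y hy =>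
          A.min'_lt_of_mem_erase_min' hne (hH₂ (hH₁ hy))
        have haH : a ∉ H₁ := fun h => lt_irrefl a (hlt a h)
        refine ⟨insert a H₁, insert_subset haA
          ((hH₁.trans hH₂).trans (erase_subset _ _)), by rw [card_insert_of_notMem haH, hc₁],
          fun x => if x = a then b else f x, fun x hx U hU hxU hUq => ?_⟩
        have haU : a ∉ U := fun h => by
          rcases mem_insert.1 hx with rfl | hx
          · exact lt_irrefl _ (hxU _ h)
          · exact lt_asymm (hxU _ h) (hlt x hx)
        have hU₁ : U ⊆ H₁ := (subset_insert_iff_of_notMem haU).1 hU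
        rcases mem_insert.1 hx with rfl | hx
        · simpa using hb U (hU₁.trans hH₁) hUq
        · have hxa : x ≠ a := fun h => haH (h ▸ hx)
          exact (hf x hx U hU₁ hxU hUq).trans (if_neg hxa).symm
    cases nonempty_fintype κ
    obtain ⟨N, hN⟩ := minHom (Fintype.card κ * m)
    refine ⟨N, fun α _ A hA c => ?_⟩
    obtain ⟨H, hHA, hH, f, hf⟩ := hN α A hA c
    have : Nonempty κ := ⟨c ∅⟩
    obtain ⟨a, -, ha⟩ := exists_le_card_fiber_of_mul_le_card_of_maps_to
      (s := H) (t := (univ : Finset κ)) (f := f) (n := m) (fun _ _ => mem_univ _) univ_nonempty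
      (by rw [card_univ, hH])
    obtain ⟨K, hK, hKm⟩ := exists_subset_card_eq ha
    refine ⟨K, (hK.trans (filter_subset _ _)).trans hHA, hKm, a, fun U hU hUq => ?_⟩
    have hne : U.Nonempty := card_pos.1 (by omega)
    have hmem := U.min'_mem hne
    have hKH : U ⊆ H := (hU.trans hK).trans (filter_subset _ _)
    rw [← insert_erase hmem, hf _ (hKH hmem) _ ((erase_subset _ _).trans hKH)
      (fun y hy => U.min'_lt_of_mem_erase_min' hne hy)
      (by rw [card_erase_of_mem hmem]; omega)]
    exact (mem_filter.1 (hK (hU hmem))).2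

/-! ### Convex linear orderings and their order types -/

section ConvexOrders

variable {X Y : Type u} [MetricSpace X] [MetricSpace Y]

theorem cLO.irrefl {r : X → X → Prop} (hr : r ∈ cLO X) (x : X) : ¬ r x x :=
  hr.1.toIsStrictOrder.toIrrefl.irrefl x

theorem cLO.trans {r : X → X → Prop} (hr : r ∈ cLO X) {x y z : X} (h : r x y) (h' : r y z) :
    r x z :=
  hr.1.toIsStrictOrder.toIsTrans.trans _ _ _ h h'

theorem cLO.asymm {r : X → X → Prop} (hr : r ∈ cLO X) {x y : X} (h : r x y) : ¬ r y x :=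
  fun h' => cLO.irrefl hr x (cLO.trans hr h h')

theorem cLO.or_of_ne {r : X → X → Prop} (hr : r ∈ cLO X) {x y : X} (h : x ≠ y) :
    r x y ∨ r y x := by
  by_contra! hn
  exact h (hr.1.toTrichotomous.trichotomous _ _ hn.1 hn.2)

theorem cLO.ne {r : X → X → Prop} (hr : r ∈ cLO X) {x y : X} (h : r x y) : x ≠ y := by
  rintro rfl
  exact cLO.irrefl hr _ h

theorem cLO.dist_lt {r : X → X → Prop} (hr : r ∈ cLO X) {x y z : X} {s : ℝ} (hxy : r x y)
    (hyz : r y z) (h : dist x z < s) : dist x y < s := by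
  have := (hr.2 x s).1 x (Metric.mem_ball_self (dist_nonneg.trans_lt h)) z
    (by rwa [Metric.mem_ball, dist_comm]) y hxy hyz
  rwa [Metric.mem_ball, dist_comm] at this

/-- Separated points may be moved inside small balls without changing their order. -/
theorem cLO.congr [IsUltrametricDist X] {r : X → X → Prop} (hr : r ∈ cLO X) {x x' y y' : X}
    {s : ℝ} (hx : dist x x' < s) (hy : dist y y' < s) (hxy : s ≤ dist x y) (h : r x y) :
    r x' y' := by
  -- One point is moved at a time: if `b` and `b'` were on different sides of `a`, convexity would
  -- put `a` within `s` of them.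
  have step : ∀ {a b b' : X}, dist b b' < s → s ≤ dist a b → (r a b → r a b') ∧
      (r b a → r b' a) := by
    intro a b b' hb hab
    have hne : a ≠ b' := by
      rintro rfl
      rw [dist_comm] at hab
      exact hb.not_ge hab
    constructor <;> intro hr₁ <;> rcases cLO.or_of_ne hr hne with h₂ | h₂
    · exact h₂
    · have := cLO.dist_lt hr h₂ hr₁ (by rwa [dist_comm])
      have h₃ := dist_triangle_max a b' b
      rw [dist_comm a b', dist_comm b' b] at h₃
      exact absurd (hab.trans h₃) (not_le.2 (max_lt this hb))
    · have := cLO.dist_lt hr hr₁ h₂ hb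
      rw [dist_comm] at this
      exact absurd this hab.not_gt
    · exact h₂
  have hxy' : s ≤ dist x' y := by
    by_contra! h'
    exact absurd (hxy.trans (dist_triangle_max x x' y)) (not_le.2 (max_lt hx h'))
  exact (step hy hxy').1 ((step hx (by rwa [dist_comm])).2 h)

/-- The ordering of `X` pulled back along a map `i : X → Y`. -/
def pullback (i : X → Y) (r : Y → Y → Prop) : X → X → Prop := fun x y => r (i x) (i y)

theorem pullback_mem_cLO {i : X → Y} (hi : Isometry i) {r : Y → Y → Prop} (hr : r ∈ cLO Y) :
    pullback i r ∈ cLO X := by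
  refine ⟨{ trichotomous := fun x y h h' => hi.injective ?_
            irrefl := fun x => cLO.irrefl hr (i x)
            trans := fun x y z => cLO.trans hr }, fun c ε => ⟨?_, ?_⟩⟩
  · exact hr.1.toTrichotomous.trichotomous _ _ h h'
  · intro x hx z hz y hxy hyz
    have := (hr.2 (i c) ε).1 (i x) (by simpa [hi.dist_eq] using hx) (i z)
      (by simpa [hi.dist_eq] using hz) (i y) hxy hyz
    simpa [hi.dist_eq] using this
  · intro x hx z hz y hxy hyz
    have := (hr.2 (i c) ε).2 (i x) (by simpa [hi.dist_eq] using hx) (i z)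
      (by simpa [hi.dist_eq] using hz) (i y) hxy hyz
    simpa [hi.dist_eq] using this

/-- A finite ultrametric space has a convex linear ordering. -/
theorem cLO_nonempty [Finite X] [IsUltrametricDist X] : (cLO X).Nonempty := by
  obtain ⟨n, ⟨ν⟩⟩ := Finite.exists_equiv_fin X
  -- Each open ball is named by the least index of its points. Distinct `x`, `y` are compared
  -- through their disjoint balls of radius `dist x y`.
  let μ : ℝ → X → ℕ := fun ε x => sInf ((fun z => (ν z : ℕ)) '' Metric.ball x ε)
  have hcongr : ∀ {ε x y}, dist x y < ε → μ ε x = μ ε y := by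
    intro ε x y h
    simp only [μ]
    rw [IsUltrametricDist.ball_eq_of_mem (x := x) (y := y)
      (by rwa [Metric.mem_ball, dist_comm])]
  have hlt : ∀ {ε x y}, 0 < ε → μ ε x = μ ε y → dist x y < ε := by
    intro ε x y hε h
    have hmem : ∀ x, μ ε x ∈ (fun z => (ν z : ℕ)) '' Metric.ball x ε := fun x =>
      Nat.sInf_mem ⟨_, x, Metric.mem_ball_self hε, rfl⟩
    obtain ⟨z, hz, hzx⟩ := hmem x
    obtain ⟨w, hw, hwy⟩ := hmem y
    obtain rfl : z = w := ν.injective (Fin.ext (hzx.trans (h.trans hwy.symm)))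
    rw [Metric.mem_ball, dist_comm] at hz
    exact (dist_triangle_max x z y).trans_lt (max_lt hz hw)
  let r : X → X → Prop := fun x y => μ (dist x y) x < μ (dist x y) y
  have hmax : ∀ x y z : X, dist x z ≤ max (dist x y) (dist y z) := dist_triangle_max
  have key : ∀ {x y z}, r x y → r y z → r x z ∧ dist x y ≤ dist x z ∧ dist y z ≤ dist x z := by
    intro x y z hxy hyz
    simp only [r] at hxy hyz ⊢
    have h₁ := hmax x y z
    have h₂ := hmax x z y
    have h₃ := hmax y x z
    rw [dist_comm z y] at h₂
    rw [dist_comm y x] at h₃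
    rcases lt_trichotomy (dist x y) (dist y z) with h | h | h
    · rw [max_eq_right h.le] at h₁
      have : dist x z = dist y z := le_antisymm h₁ ((le_max_iff.1 h₃).resolve_left h.not_ge)
      rw [this, hcongr h]
      exact ⟨hyz, h.le, le_rfl⟩
    · rw [h, max_self] at h₁
      rw [h] at hxy
      have : dist x z = dist y z := by
        refine le_antisymm h₁ (not_lt.1 fun hlt' => ?_)
        rw [hcongr hlt'] at hxy
        exact lt_asymm hxy hyz
      rw [this]
      exact ⟨hxy.trans hyz, h.le, le_rfl⟩
    · rw [max_eq_left h.le] at h₁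
      have : dist x z = dist x y := le_antisymm h₁ ((le_max_iff.1 h₂).resolve_right h.not_ge)
      rw [this, ← hcongr h]
      exact ⟨hxy, le_rfl, h.le⟩
  refine ⟨r, { trichotomous := fun x y h h' => ?_
               irrefl := fun x => lt_irrefl _
               trans := fun x y z h h' => (key h h').1 }, fun c ε => ⟨?_, ?_⟩⟩
  · by_contra hne
    simp only [r, not_lt, dist_comm y x] at h h'
    exact lt_irrefl _ (hlt (dist_pos.2 hne) (le_antisymm h' h))
  · intro x hx z hz y hxy hyz
    rw [Metric.mem_ball, dist_comm] at hz
    exact (hmax y x c).trans_lt (max_lt (by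
      rw [dist_comm]
      exact (key hxy hyz).2.1.trans_lt ((hmax x c z).trans_lt (max_lt hx hz))) hx)
  · intro x hx z hz y hxy hyz
    rw [Metric.mem_closedBall, dist_comm] at hz
    exact (hmax y x c).trans (max_le (by
      rw [dist_comm]
      exact (key hxy hyz).2.1.trans ((hmax x c z).trans (max_le hx hz))) hx)

/-- The isometry group of a finite space acts freely on the convex linear orderings. -/
theorem eq_of_preserves_cLO [Finite X] {r r' : X → X → Prop} (hr : r ∈ cLO X)
    {e e' : X ≃ᵢ X} (he : ∀ x y, r' x y ↔ r (e x) (e y))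
    (he' : ∀ x y, r' x y ↔ r (e' x) (e' y)) : e = e' := by
  have := hr.1
  have : IsWellFounded X r := ⟨Finite.wellFounded_of_trans_of_irrefl r⟩
  -- The two isometries differ by an automorphism of a well-order, which must be the identity.
  let f : r ≃r r := ⟨(e.symm.trans e').toEquiv, fun {x y} => by
    simp only [IsometryEquiv.coe_toEquiv, IsometryEquiv.trans_apply]
    rw [← he', he, e.apply_symm_apply, e.apply_symm_apply]⟩
  have hf : ∀ x, f x = x := fun x => by
    have : f.toInitialSeg = InitialSeg.refl r := Subsingleton.elim _ _
    exact congrArg (fun g : InitialSeg r r => g x) this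
  ext x
  have := hf (e x)
  simpa [f] using this.symm

/-- A convex ordering is the pullback of the chosen representative of its type along an isometry,
which is unique because the action is free. -/
theorem card_cLO_eq [Finite X] :
    Nat.card (cLO X) = Nat.card (OrderTypes X) * Nat.card (X ≃ᵢ X) := by
  rw [← Nat.card_prod]
  symm
  refine Nat.card_eq_of_bijective
    (fun p : OrderTypes X × (X ≃ᵢ X) =>
      (⟨pullback p.2 p.1.out.1, pullback_mem_cLO p.2.isometry p.1.out.2⟩ : cLO X)) ⟨?_, ?_⟩
  · rintro ⟨q, e⟩ ⟨q', e'⟩ h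
    have h : pullback e q.out.1 = pullback e' q'.out.1 := congrArg Subtype.val h
    have hq : q = q' := by
      rw [← q.out_eq, ← q'.out_eq]
      refine Quotient.sound ⟨e.symm.trans e', fun x y => ?_⟩
      have := congrFun (congrFun h (e.symm x)) (e.symm y)
      simp only [pullback, e.apply_symm_apply] at this
      rw [this]; rfl
    subst hq
    rw [Prod.mk.injEq]
    refine ⟨rfl, eq_of_preserves_cLO q.out.2 (r' := pullback e q.out.1) (fun _ _ => Iff.rfl) ?_⟩
    rw [h]
    exact fun _ _ => Iff.rfl
  · intro r
    obtain ⟨e, he⟩ := Quotient.exact (Quotient.out_eq (Quotient.mk (orderTypeSetoid X) r)).symm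
    exact ⟨(Quotient.mk _ r, e), Subtype.ext (funext₂ fun x y => propext (he x y).symm)⟩

end ConvexOrders

end UltraRamsey

namespace UltraRamsey

/-! ### Labelled trees of balls -/

/-- The depth-first preordering of the pairs `(x, s)`, regarded as names for the open balls with
centre `x` and radius `s`. -/
def ballLE {X : Type u} [MetricSpace X] (D : Finset ℝ) (r : X → X → Prop) (p q : X × D) : Prop :=
  (dist p.1 q.1 < max (p.2 : ℝ) q.2 ∧ q.2 ≤ p.2) ∨
    (max (p.2 : ℝ) q.2 ≤ dist p.1 q.1 ∧ r p.1 q.1)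

/-- A labelling of the balls of `X` which is compatible with the depth-first preordering. -/
def IsLabelling {X : Type u} [MetricSpace X] {D : Finset ℝ} {α : Type*} [LinearOrder α]
    (r : X → X → Prop) (v : X × D → α) : Prop :=
  ∀ p q, v p ≤ v q ↔ ballLE D r p q

section Labelling

variable {X Y : Type u} [MetricSpace X] [MetricSpace Y] {D : Finset ℝ}
variable {α β : Type*} [LinearOrder α] [LinearOrder β]

/-- Two balls are nested or disjoint. In the mixed cases the centre moves inside a ball, which
`cLO.congr` allows; if both comparisons come from `r`, convexity keeps the outer balls from
swallowing the middle one. -/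
theorem ballLE_trans [IsUltrametricDist X] {r : X → X → Prop} (hr : r ∈ cLO X)
    {p q w : X × D} (hpq : ballLE D r p q) (hqw : ballLE D r q w) : ballLE D r p w := by
  obtain ⟨a, s⟩ := p
  obtain ⟨b, t⟩ := q
  obtain ⟨c, u⟩ := w
  simp only [ballLE, ← Subtype.coe_le_coe] at hpq hqw ⊢
  have h₁ := dist_triangle_max a b c
  have h₂ := dist_triangle_max b a c
  have h₃ := dist_triangle_max a c b
  rw [dist_comm b a] at h₂
  rw [dist_comm c b] at h₃
  rcases hpq with ⟨hab, hts⟩ | ⟨hab, rab⟩ <;> rcases hqw with ⟨hbc, hut⟩ | ⟨hbc, rbc⟩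
  · rw [max_eq_left hts] at hab
    rw [max_eq_left hut] at hbc
    exact .inl ⟨lt_max_of_lt_left (h₁.trans_lt (max_lt hab (hbc.trans_le hts))), hut.trans hts⟩
  · rw [max_eq_left hts] at hab
    rcases lt_or_ge (dist a c) (max (s : ℝ) u) with hac | hac
    · refine .inl ⟨hac, not_lt.1 fun hsu => ?_⟩
      rw [max_eq_right hsu.le] at hac
      exact absurd ((le_max_right _ _).trans hbc)
        (not_le.2 (h₂.trans_lt (max_lt (hab.trans hsu) hac)))
    · refine .inr ⟨hac, ?_⟩
      have hac' : (s : ℝ) ≤ dist a c := (le_max_left _ _).trans hac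
      have hbc' : (s : ℝ) ≤ dist b c :=
        (le_max_iff.1 (hac'.trans h₁)).resolve_left hab.not_ge
      exact cLO.congr hr (by rwa [dist_comm])
        (by rw [dist_self]; exact dist_nonneg.trans_lt hab) hbc' rbc
  · rw [max_eq_left hut] at hbc
    have hta : (t : ℝ) ≤ dist a b := (le_max_right _ _).trans hab
    rcases lt_or_ge (dist a c) (max (s : ℝ) u) with hac | hac
    · refine .inl ⟨hac, not_lt.1 fun hsu => ?_⟩
      rw [max_eq_right hsu.le] at hac
      exact absurd hta (not_le.2 (h₃.trans_lt (max_lt (hac.trans_le hut) hbc)))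
    · exact .inr ⟨hac, cLO.congr hr
        (by rw [dist_self]; exact dist_nonneg.trans_lt hbc) hbc hta rab⟩
  · rcases lt_or_ge (dist a c) (max (s : ℝ) u) with hac | hac
    · refine .inl ⟨hac, not_lt.1 fun hsu => ?_⟩
      rw [max_eq_right hsu.le] at hac
      have hab' := cLO.dist_lt hr rab rbc hac
      exact absurd ((le_max_right _ _).trans hbc) (not_le.2 (h₂.trans_lt (max_lt hab' hac)))
    · exact .inr ⟨hac, cLO.trans hr rab rbc⟩

theorem ballLE_total (hD : ∀ s ∈ D, 0 < s) {r : X → X → Prop} (hr : r ∈ cLO X)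
    (p q : X × D) : ballLE D r p q ∨ ballLE D r q p := by
  obtain ⟨a, s⟩ := p
  obtain ⟨b, t⟩ := q
  simp only [ballLE, dist_comm b a, max_comm (t : ℝ) s]
  rcases lt_or_ge (dist a b) (max (s : ℝ) t) with h | h
  · rcases le_total s t with hst | hst
    · exact .inr (.inl ⟨h, hst⟩)
    · exact .inl (.inl ⟨h, hst⟩)
  · have hne : a ≠ b := dist_pos.1 (((hD s s.2).trans_le (le_max_left _ _)).trans_le h)
    rcases cLO.or_of_ne hr hne with h' | h'
    · exact .inl (.inr ⟨h, h'⟩)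
    · exact .inr (.inr ⟨h, h'⟩)

theorem exists_isLabelling [Finite X] [IsUltrametricDist X] (hD : ∀ s ∈ D, 0 < s)
    {r : X → X → Prop} (hr : r ∈ cLO X) :
    ∃ v : X × D → Fin (Nat.card (X × D)), IsLabelling r v := by
  classical
  cases nonempty_fintype X
  -- The label of `p` is the number of names strictly before it, so equivalent names share a label.
  let below : X × D → Finset (X × D) := fun p => Finset.univ.filter fun q => ¬ ballLE D r p q
  have hrefl : ∀ p : X × D, ballLE D r p p := fun p => by simpa using ballLE_total hD hr p p
  have hlt : ∀ p, (below p).card < Nat.card (X × D) := fun p => by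
    rw [Nat.card_eq_fintype_card, ← Finset.card_univ]
    refine Finset.card_lt_card (Finset.filter_ssubset.2 ⟨p, Finset.mem_univ _, ?_⟩)
    exact not_not.2 (hrefl p)
  have hmono : ∀ {p q}, ballLE D r p q → below p ⊆ below q := fun {p q} h w hw => by
    simp only [below, Finset.mem_filter, Finset.mem_univ, true_and] at hw ⊢
    exact fun h' => hw (ballLE_trans hr h h')
  refine ⟨fun p => ⟨_, hlt p⟩, fun p q => ?_⟩
  rw [Fin.mk_le_mk]
  refine ⟨fun h => ?_, fun h => Finset.card_le_card (hmono h)⟩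
  by_contra hn
  have hqp := (ballLE_total hD hr p q).resolve_left hn
  refine absurd h (not_le.2 (Finset.card_lt_card ⟨hmono hqp, fun hsub => ?_⟩))
  have : q ∈ below p := by simpa [below] using hn
  have := hsub this
  simp only [below, Finset.mem_filter, Finset.mem_univ, true_and] at this
  exact this (hrefl q)

namespace IsLabelling

variable {r : X → X → Prop} {v : X × D → α}

theorem eq_iff (hv : IsLabelling r v) (p q : X × D) :
    v p = v q ↔ p.2 = q.2 ∧ dist p.1 q.1 < max (p.2 : ℝ) q.2 ∨
      (max (p.2 : ℝ) q.2 ≤ dist p.1 q.1 ∧ r p.1 q.1 ∧ r q.1 p.1) := by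
  rw [le_antisymm_iff, hv, hv, ballLE, ballLE, dist_comm q.1, max_comm (q.2 : ℝ)]
  constructor
  · rintro ⟨h | h, h' | h'⟩
    · exact .inl ⟨le_antisymm h'.2 h.2, h.1⟩
    · exact absurd h'.1 h.1.not_ge
    · exact absurd h.1 h'.1.not_ge
    · exact .inr ⟨h.1, h.2, h'.2⟩
  · rintro (⟨h, h'⟩ | ⟨h₁, h₂, h₃⟩)
    · exact ⟨.inl ⟨h', h.ge⟩, .inl ⟨h', h.le⟩⟩
    · exact ⟨.inr ⟨h₁, h₂⟩, .inr ⟨h₁, h₃⟩⟩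

/-- Asymmetry of `r` removes the second alternative of `eq_iff`. The right-hand side no longer
mentions `r`, so which names share a label depends on the metric alone. -/
theorem eq_iff_dist_lt (hr : r ∈ cLO X) (hv : IsLabelling r v) (p q : X × D) :
    v p = v q ↔ p.2 = q.2 ∧ dist p.1 q.1 < p.2 := by
  rw [hv.eq_iff]
  constructor
  · rintro (⟨h, h'⟩ | ⟨-, h, h'⟩)
    · rw [h, max_self] at h'
      exact ⟨h, h ▸ h'⟩
    · exact absurd h' (cLO.asymm hr h)
  · rintro ⟨h, h'⟩
    exact .inl ⟨h, lt_max_of_lt_left h'⟩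

theorem lt_of_le_dist (hr : r ∈ cLO X) (hv : IsLabelling r v) {x y : X} {s : D}
    (hs : (s : ℝ) ≤ dist x y) (h : r x y) : v (x, s) < v (y, s) := by
  refine lt_of_le_of_ne ((hv _ _).2 (.inr ⟨by simpa using hs, h⟩)) fun heq => ?_
  exact absurd ((hv.eq_iff_dist_lt hr _ _).1 heq).2 hs.not_gt

theorem comp_strictMono (hv : IsLabelling r v) {h : α → β} (hh : StrictMono h) :
    IsLabelling r (h ∘ v) := fun p q => by
  rw [Function.comp_apply, Function.comp_apply, hh.le_iff_le, hv]

/-- Restricting the labels of `Y` to a copy of `X` labels `X` for the inherited ordering. -/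
theorem comp_isometry {r : Y → Y → Prop} {v : Y × D → α} (hv : IsLabelling r v) {i : X → Y}
    (hi : Isometry i) : IsLabelling (pullback i r) fun p : X × D => v (i p.1, p.2) :=
  fun p q => by simp only [hv _ _, ballLE, hi.dist_eq, pullback]

/-- A labelling is determined by its set of labels. -/
theorem eq_of_range_eq [Finite X] {w : X × D → α} (hv : IsLabelling r v) (hw : IsLabelling r w)
    (h : Set.range v = Set.range w) : v = w := by
  have hvw : ∀ p q, v p ≤ v q ↔ w p ≤ w q := fun p q => (hv p q).trans (hw p q).symm
  -- Both labellings realise the same preorder, so `w` factors through `v` by a strictly increasing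
  -- `g`. Having the same range as the inclusion, `g` equals it.
  let g : Set.range v → α := fun a => w a.2.choose
  have hg : ∀ p, g ⟨v p, p, rfl⟩ = w p := fun p => by
    have hc : v (Exists.choose (⟨p, rfl⟩ : ∃ q, v q = v p)) = v p :=
      Exists.choose_spec (⟨p, rfl⟩ : ∃ q, v q = v p)
    exact le_antisymm ((hvw _ _).1 hc.le) ((hvw _ _).1 hc.ge)
  have hmono : StrictMono g := by
    rintro ⟨_, p, rfl⟩ ⟨_, q, rfl⟩ hpq
    rw [hg, hg]
    exact not_le.1 fun hle => absurd ((hvw _ _).2 hle) (not_le.2 hpq)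
  have hrange : Set.range g = Set.range w := by
    ext a
    constructor
    · rintro ⟨⟨_, p, rfl⟩, rfl⟩
      exact ⟨p, (hg p).symm⟩
    · rintro ⟨p, rfl⟩
      exact ⟨⟨v p, p, rfl⟩, hg p⟩
  have hval : StrictMono (Subtype.val : Set.range v → α) := fun _ _ h => h
  have : g = Subtype.val := by
    rw [← hmono.range_inj hval, hrange, Subtype.range_coe, h]
  funext p
  rw [← hg p, this]

end IsLabelling

/-- The number of labels used by a labelling does not depend on the ordering. -/
theorem exists_card_labels (X : Type u) [MetricSpace X] [Finite X] (D : Finset ℝ) :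
    ∃ n : ℕ, ∀ (α : Type u) [LinearOrder α] (r : X → X → Prop) (v : X × D → α), r ∈ cLO X →
      IsLabelling r v → (Set.range v).ncard = n := by
  by_cases h : ∃ (α : Type u) (_ : LinearOrder α) (r : X → X → Prop) (v : X × D → α),
      r ∈ cLO X ∧ IsLabelling r v
  · obtain ⟨α, _, r, v, hr, hv⟩ := h
    refine ⟨(Set.range v).ncard, fun β _ r' w hr' hw => ?_⟩
    have hker : Setoid.ker w = Setoid.ker v := Setoid.ext fun p q => by
      rw [Setoid.ker_def, Setoid.ker_def, hv.eq_iff_dist_lt hr, hw.eq_iff_dist_lt hr']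
    rw [← Nat.card_coe_set_eq, ← Nat.card_coe_set_eq]
    exact Nat.card_congr (((Setoid.quotientKerEquivRange w).symm.trans
      (Quotient.congrRight fun p q => by rw [hker])).trans (Setoid.quotientKerEquivRange v))
  · refine ⟨0, fun α _ r v hr hv => absurd ⟨α, _, r, v, hr, hv⟩ h⟩

end Labelling

/-! ### Regular trees -/

/-- The leaves of the regular tree whose levels are indexed by `D`, the children of each node
being indexed by `α`. -/
def Leaves (D : Finset ℝ) (α : Type u) : Type u := D → α

namespace Leaves

variable {D : Finset ℝ} {α : Type u}

-- Reading coordinates from the largest level down, two leaves lie in the same open ball of radius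
-- `s` when they agree at all levels from `s` upwards; lower coordinates play no role.
open Classical in
noncomputable instance : Dist (Leaves D α) :=
  ⟨fun x y => ((Finset.univ.filter fun s : D => x s ≠ y s).sup fun s => (s : ℝ).toNNReal : NNReal)⟩

theorem dist_nonneg' (x y : Leaves D α) : 0 ≤ dist x y := NNReal.coe_nonneg _

theorem dist_lt_iff {x y : Leaves D α} {ε : ℝ} (hε : 0 < ε) :
    dist x y < ε ↔ ∀ s : D, ε ≤ s → x s = y s := by
  lift ε to NNReal using hε.le
  have hε' : (⊥ : NNReal) < ε := by exact_mod_cast hε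
  simp only [dist, NNReal.coe_lt_coe, Finset.sup_lt_iff hε', Finset.mem_filter,
    Finset.mem_univ, true_and]
  refine forall_congr' fun s => ?_
  rw [← not_imp_not, not_lt, not_not, ← NNReal.coe_le_coe, Real.coe_toNNReal', le_max_iff]
  simp [hε.not_ge]

theorem dist_le_iff {x y : Leaves D α} {ε : ℝ} (hε : 0 ≤ ε) :
    dist x y ≤ ε ↔ ∀ s : D, ε < s → x s = y s := by
  constructor
  · intro h s hs
    exact (dist_lt_iff (hε.trans_lt hs)).1 (h.trans_lt hs) s le_rfl
  · intro h
    refine le_of_forall_gt fun δ hδ => ?_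
    rw [dist_lt_iff (hε.trans_lt hδ)]
    exact fun s hs => h s (hδ.trans_le hs)

theorem dist_mem [Fact (∀ s ∈ D, 0 < s)] {x y : Leaves D α} (h : x ≠ y) : dist x y ∈ D := by
  classical
  have hne : (Finset.univ.filter fun s : D => x s ≠ y s).Nonempty := by
    by_contra hn
    rw [Finset.not_nonempty_iff_eq_empty, Finset.filter_eq_empty_iff] at hn
    exact h (funext fun s => not_not.1 (hn (Finset.mem_univ s)))
  obtain ⟨s, -, hs⟩ := Finset.exists_mem_eq_sup _ hne fun s : D => (s : ℝ).toNNReal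
  have : dist x y = s := by
    change (((_ : Finset D).sup _ : NNReal) : ℝ) = s
    rw [hs, Real.coe_toNNReal _ ((Fact.out : ∀ s ∈ D, 0 < s) s s.2).le]
  exact this ▸ s.2

noncomputable instance [hD : Fact (∀ s ∈ D, 0 < s)] : MetricSpace (Leaves D α) where
  dist_self x := by
    refine le_antisymm (le_of_forall_pos_lt_add fun ε hε => ?_) (dist_nonneg' x x)
    rw [zero_add, dist_lt_iff hε]
    exact fun _ _ => rfl
  dist_comm x y := by
    have h : ∀ x y : Leaves D α, dist x y ≤ dist y x := fun x y =>
      (dist_le_iff (dist_nonneg' _ _)).2 fun s hs =>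
        ((dist_le_iff (dist_nonneg' y x)).1 le_rfl s hs).symm
    exact le_antisymm (h x y) (h y x)
  dist_triangle x y z := by
    refine le_of_forall_pos_lt_add fun ε hε => ?_
    have h₁ := dist_nonneg' x y
    have h₂ := dist_nonneg' y z
    rw [dist_lt_iff (by linarith)]
    intro s hs
    have hxy : dist x y < dist x y + dist y z + ε := by linarith
    have hyz : dist y z < dist x y + dist y z + ε := by linarith
    rw [dist_lt_iff (by linarith)] at hxy hyz
    exact (hxy s hs).trans (hyz s hs)
  eq_of_dist_eq_zero {x y} h := by
    by_contra hne
    exact (hD.out _ (dist_mem hne)).ne' h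

variable [hD : Fact (∀ s ∈ D, 0 < s)]

instance : IsUltrametricDist (Leaves D α) where
  dist_triangle_max x y z := by
    refine le_of_forall_gt fun ε hε => ?_
    rw [max_lt_iff] at hε
    have h : 0 < ε := dist_nonneg.trans_lt hε.1
    rw [dist_lt_iff h, dist_lt_iff h] at hε
    rw [dist_lt_iff h]
    exact fun s hs => (hε.1 s hs).trans (hε.2 s hs)

instance [Finite α] : Finite (Leaves D α) := inferInstanceAs (Finite (D → α))

theorem finUltrametric [Finite α] {S : Set ℝ} (hS : ∀ s ∈ D, s ∈ S) :
    FinUltrametric S (Leaves D α) inferInstance :=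
  ⟨inferInstance, inferInstance, fun _ _ h => hS _ (dist_mem h)⟩

theorem dist_eq_of {x y : Leaves D α} {s : D} (h : ∀ t, s < t → x t = y t) (hs : x s ≠ y s) :
    dist x y = s := by
  refine le_antisymm ((dist_le_iff (hD.out s s.2).le).2 h) (not_lt.1 fun hlt => hs ?_)
  exact (dist_lt_iff (hD.out s s.2)).1 hlt s le_rfl

/-- A family of labels which separates exactly the disjoint balls gives an isometry. -/
theorem isometry_of_labels {X : Type u} [MetricSpace X] {f : X → Leaves D α}
    (hX : ∀ x y : X, x ≠ y → dist x y ∈ D)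
    (hf : ∀ x y (s : D), f x s = f y s ↔ dist x y < s) : Isometry f := by
  refine Isometry.of_dist_eq fun x y => ?_
  by_cases hxy : x = y
  · subst hxy; simp
  · refine dist_eq_of (s := ⟨dist x y, hX x y hxy⟩) (fun t ht => (hf x y t).2 ht) fun h => ?_
    exact lt_irrefl _ ((hf x y _).1 h)

end Leaves

end UltraRamsey

/-! ### Convex orderings of a regular tree -/

namespace UltraRamsey

namespace Leaves

variable {D : Finset ℝ} {α : Type u}

open Classical in
/-- The leaf obtained from `y` by changing the branch taken at level `s`. -/
noncomputable def switch (y : Leaves D α) (s : D) (a : α) : Leaves D α :=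
  Function.update (β := fun _ => α) y s a

theorem switch_same (y : Leaves D α) (s : D) (a : α) : switch y s a s = a :=
  Function.update_self ..

theorem switch_of_ne (y : Leaves D α) {s t : D} (h : t ≠ s) (a : α) : switch y s a t = y t :=
  Function.update_of_ne h ..

theorem switch_eq_self (y : Leaves D α) (s : D) : switch y s (y s) = y :=
  Function.update_eq_self ..

variable [hD : Fact (∀ s ∈ D, 0 < s)]

theorem dist_switch {y : Leaves D α} {s : D} {a : α} (h : a ≠ y s) :
    dist (switch y s a) y = s :=
  dist_eq_of (fun _ ht => switch_of_ne y ht.ne' a) (by rwa [switch_same])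

/-- Above level `s` the leaves already agree, and at `s` they are made to agree. Hence the weak
inequality suffices, and siblings may be merged. -/
theorem dist_switch_switch_lt {y z : Leaves D α} {s : D} (h : dist y z ≤ s) (a : α) :
    dist (switch y s a) (switch z s a) < s := by
  have hs := hD.out s s.2
  rw [dist_lt_iff hs]
  intro t hst
  rcases eq_or_ne t s with rfl | hts
  · rw [switch_same, switch_same]
  · rw [switch_of_ne _ hts, switch_of_ne _ hts]
    exact (dist_le_iff hs.le).1 h t (lt_of_le_of_ne hst fun h => hts (Subtype.ext h.symm))

open Classical in
/-- The position of the branch of `y` at level `s` among its siblings. -/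
noncomputable def rank [Fintype α] (r : Leaves D α → Leaves D α → Prop) (y : Leaves D α) (s : D) :
    ℕ :=
  (Finset.univ.filter fun a => r (switch y s a) y).card

variable [Fintype α] {r : Leaves D α → Leaves D α → Prop}

theorem rank_lt_card (hr : r ∈ cLO (Leaves D α)) (y : Leaves D α) (s : D) :
    rank r y s < Fintype.card α := by
  classical
  rw [← Finset.card_univ]
  refine Finset.card_lt_card (Finset.filter_ssubset.2 ⟨y s, Finset.mem_univ _, ?_⟩)
  rw [switch_eq_self]
  exact cLO.irrefl hr y

theorem rank_congr (hr : r ∈ cLO (Leaves D α)) {y z : Leaves D α} {s : D} (h : dist y z < s) :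
    rank r y s = rank r z s := by
  classical
  have key : ∀ {y z : Leaves D α} (a : α), dist y z < s → r (switch y s a) y →
      r (switch z s a) z := by
    intro y z a h hy
    have hne : a ≠ y s := by
      rintro rfl
      rw [switch_eq_self] at hy
      exact cLO.irrefl hr y hy
    exact cLO.congr hr (dist_switch_switch_lt h.le a) h (dist_switch hne).ge hy
  exact congrArg Finset.card
    (Finset.filter_congr fun a _ => ⟨key a h, key a (by rwa [dist_comm])⟩)

/-- Each branch placed before that of `y` is also before that of `z`, and the branch of `y` is one
more. -/
theorem rank_lt_rank (hr : r ∈ cLO (Leaves D α)) {y z : Leaves D α} {s : D} (h : dist y z = s)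
    (hyz : r y z) : rank r y s < rank r z s := by
  have hs : (0 : ℝ) < s := hD.out s s.2
  have near : ∀ {x y : Leaves D α}, dist x y = s → dist (switch y s (x s)) x < s := by
    intro x y h
    have := dist_switch_switch_lt (z := x) (y := y) (by rw [dist_comm, h]) (x s)
    rwa [switch_eq_self] at this
  have hzy : dist z y = s := by rw [dist_comm, h]
  refine Finset.card_lt_card ((Finset.ssubset_iff_of_subset ?_).2 ⟨y s, ?_, ?_⟩)
  · intro a ha
    simp only [Finset.mem_filter, Finset.mem_univ, true_and] at ha ⊢
    have hay : a ≠ y s := by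
      rintro rfl
      rw [switch_eq_self] at ha
      exact cLO.irrefl hr y ha
    have haz : a ≠ z s := by
      rintro rfl
      have := cLO.congr hr (s := s) (by rwa [dist_self]) (by rw [dist_comm]; exact near hzy)
        h.ge hyz
      exact cLO.asymm hr ha this
    have h₁ : r (switch z s a) y := cLO.congr hr (s := s) (dist_switch_switch_lt h.le a)
      (by rwa [dist_self]) (dist_switch hay).ge ha
    exact cLO.trans hr h₁ hyz
  · simp only [Finset.mem_filter, Finset.mem_univ, true_and]
    exact cLO.congr hr (s := s) (by rw [dist_comm]; exact near h) (by rwa [dist_self]) h.ge hyz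
  · simp only [Finset.mem_filter, Finset.mem_univ, true_and, switch_eq_self]
    exact cLO.irrefl hr y

/-- Every convex ordering of a sufficiently branching regular tree contains all convexly ordered
spaces `X` with distances in `D`. -/
theorem exists_isometry_pullback_eq {X : Type u} [MetricSpace X] [Finite X] [IsUltrametricDist X]
    (hX : ∀ x y : X, x ≠ y → dist x y ∈ D)
    {r : Leaves D (ULift.{u} (Fin (Nat.card (X × D)))) →
      Leaves D (ULift.{u} (Fin (Nat.card (X × D)))) → Prop}
    (hr : r ∈ cLO _) {ρ : X → X → Prop} (hρ : ρ ∈ cLO X) :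
    ∃ i : X → Leaves D (ULift.{u} (Fin (Nat.card (X × D)))), Isometry i ∧ pullback i r = ρ := by
  let L := Leaves D (ULift.{u} (Fin (Nat.card (X × D))))
  obtain ⟨v, hv⟩ := exists_isLabelling hD.out hρ
  -- Labels serve as branch indices, which is why the branching number is that of `X × D`.
  let f : X → L := fun x s => ⟨v (x, s)⟩
  -- Replacing branches by their ranks is an isometry carrying `r` to the lexicographic order, read
  -- from the largest level. The labelled copy `f` of `X` is then pulled back through `Φ`.
  let Φ : L → L := fun y s => ⟨⟨rank r y s, by simpa using rank_lt_card hr y s⟩⟩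
  have hΦ : ∀ y z s, Φ y s = Φ z s ↔ rank r y s = rank r z s := fun y z s => by
    simp [Φ, ULift.ext_iff, Fin.ext_iff]
  have hΦiso : Isometry Φ := by
    refine Isometry.of_dist_eq fun y z => ?_
    by_cases hyz : y = z
    · subst hyz; simp
    · let s : D := ⟨dist y z, dist_mem hyz⟩
      refine dist_eq_of (s := s)
        (fun t ht => (hΦ _ _ _).2 (rank_congr hr ht)) fun h => ?_
      rw [hΦ] at h
      rcases cLO.or_of_ne hr hyz with h' | h'
      · exact (rank_lt_rank hr (s := s) rfl h').ne h
      · exact (rank_lt_rank hr (s := s) (dist_comm z y) h').ne' h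
  have hf : Isometry f := isometry_of_labels hX fun x y s => by
    simpa [f, ULift.ext_iff] using hv.eq_iff_dist_lt hρ (x, s) (y, s)
  have hsurj : Function.Surjective Φ := Finite.surjective_of_injective hΦiso.injective
  choose g hg using fun x => hsurj (f x)
  have hgiso : Isometry g := Isometry.of_dist_eq fun x y => by
    rw [← hΦiso.dist_eq, hg, hg, hf.dist_eq]
  have hlt : ∀ {x y}, ρ x y → r (g x) (g y) := by
    intro x y hxy
    have hne := cLO.ne hρ hxy
    let s : D := ⟨dist x y, hX x y hne⟩
    refine (cLO.or_of_ne hr (hgiso.injective.ne hne)).resolve_right fun h => ?_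
    have h₁ := rank_lt_rank hr (s := s) (by rw [hgiso.dist_eq, dist_comm]) h
    have h₂ := hv.lt_of_le_dist hρ (s := s) le_rfl hxy
    have hx := congrArg (fun w : L => (w s).down.1) (hg x)
    have hy := congrArg (fun w : L => (w s).down.1) (hg y)
    simp only [Φ, f] at hx hy
    rw [hx, hy] at h₁
    exact lt_asymm h₁ h₂
  refine ⟨g, hgiso, funext₂ fun x y => propext ⟨fun h => ?_, hlt⟩⟩
  have hne : x ≠ y := by
    rintro rfl
    exact cLO.irrefl hr _ h
  exact (cLO.or_of_ne hρ hne).resolve_right fun h' => cLO.asymm hr h (hlt h')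

end Leaves

/-! ### The two bounds for the Ramsey degree -/

section Degree

variable {X : Type u} [MetricSpace X]

theorem range_mem_copies {Z : Type u} [MetricSpace Z] {i : X → Z} (hi : Isometry i) :
    Set.range i ∈ copies X Z :=
  ⟨hi.isometryEquivOnRange.symm⟩

theorem exists_isometry_of_mem_copies {Z : Type u} [MetricSpace Z] {A : Set Z}
    (hA : A ∈ copies X Z) : ∃ i : X → Z, Isometry i ∧ Set.range i = A := by
  obtain ⟨e⟩ := hA
  refine ⟨fun x => (e.symm x : Z), isometry_subtype_coe.comp e.symm.isometry, ?_⟩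
  ext z
  constructor
  · rintro ⟨x, rfl⟩
    exact (e.symm x).2
  · intro hz
    exact ⟨e ⟨z, hz⟩, by simp⟩

/-- A finite set of positive reals containing all the nonzero distances of `Y`. -/
theorem exists_finset_dist (Y : Type u) [MetricSpace Y] [Finite Y] :
    ∃ D : Finset ℝ, (∀ s ∈ D, ∃ x y : Y, x ≠ y ∧ dist x y = s) ∧
      ∀ x y : Y, x ≠ y → dist x y ∈ D := by
  classical
  cases nonempty_fintype Y
  refine ⟨(Finset.univ.filter fun p : Y × Y => p.1 ≠ p.2).image fun p => dist p.1 p.2, ?_, ?_⟩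
  · intro s hs
    obtain ⟨p, hp, rfl⟩ := Finset.mem_image.1 hs
    exact ⟨p.1, p.2, (Finset.mem_filter.1 hp).2, rfl⟩
  · intro x y h
    exact Finset.mem_image.2 ⟨(x, y), by simpa using h, rfl⟩

theorem exists_arrows {S : Set ℝ} (hX : FinUltrametric S X inferInstance)
    (Y : Type u) [MetricSpace Y] (hY : FinUltrametric S Y inferInstance) {k : ℕ} (hk : 0 < k) :
    ∃ (Z : Type u) (_ : MetricSpace Z), FinUltrametric S Z inferInstance ∧
      Arrows X Y Z k (Nat.card (OrderTypes X)) := by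
  classical
  obtain ⟨_, _, -⟩ := hX
  obtain ⟨_, _, hYS⟩ := hY
  obtain ⟨D, hDY, hYD⟩ := exists_finset_dist Y
  have hD : ∀ s ∈ D, 0 < s := fun s hs => by
    obtain ⟨x, y, hxy, rfl⟩ := hDY s hs
    exact dist_pos.2 hxy
  have : Fact (∀ s ∈ D, 0 < s) := ⟨hD⟩
  obtain ⟨ρ, hρ⟩ := cLO_nonempty (X := Y)
  obtain ⟨v, hv⟩ := exists_isLabelling hD hρ
  obtain ⟨q, hq⟩ := exists_card_labels X D
  -- A colour is a function on `cLO X`, so one homogeneous set serves all orderings at once. Its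
  -- size is the number of labels available to `v`.
  obtain ⟨N, hN⟩ := exists_homogeneous_finset.{u} (κ := cLO X → Fin k) q (Nat.card (Y × D))
  let α := ULift.{u} (Fin N)
  refine ⟨Leaves D α, inferInstance, Leaves.finUltrametric fun s hs => ?_, fun χ => ?_⟩
  · obtain ⟨x, y, hxy, rfl⟩ := hDY s hs
    exact hYS x y hxy
  -- The default is needed because `X` may have distances outside `D`, in which case a labelling
  -- need not give a copy.
  let χ' : Set (Leaves D α) → Fin k := fun A =>
    if h : A ∈ copies X (Leaves D α) then χ ⟨A, h⟩ else ⟨0, hk⟩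
  let leaf : (X × D → α) → X → Leaves D α := fun w x s => w (x, s)
  let c : Finset α → cLO X → Fin k := fun V r =>
    if h : ∃ w : X × D → α, IsLabelling r.1 w ∧ Set.range w = V then
      χ' (Set.range (leaf h.choose)) else ⟨0, hk⟩
  have hc : ∀ (r : cLO X) (w : X × D → α) (V : Finset α), IsLabelling r.1 w → Set.range w = V →
      c V r = χ' (Set.range (leaf w)) := by
    intro r w V hw hV
    have h : ∃ w : X × D → α, IsLabelling r.1 w ∧ Set.range w = V := ⟨w, hw, hV⟩
    have : h.choose = w := h.choose_spec.1.eq_of_range_eq hw (h.choose_spec.2.trans hV.symm)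
    simp only [c, dif_pos h, this]
  obtain ⟨H, -, hH, a, ha⟩ := hN α Finset.univ (by simp [α]) c
  let h := H.orderEmbOfFin hH
  have hv' : IsLabelling ρ (h ∘ v) := hv.comp_strictMono h.strictMono
  let f : Y → Leaves D α := fun y s => h (v (y, s))
  have hf : Isometry f := Leaves.isometry_of_labels hYD fun x y s => 
    (hv'.eq_iff_dist_lt hρ (x, s) (y, s)).trans (and_iff_right rfl)
  refine ⟨Set.range f, range_mem_copies hf, ?_⟩
  have hsub : χ '' {A : copies X (Leaves D α) | (A : Set (Leaves D α)) ⊆ Set.range f} ⊆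
      Set.range fun o : OrderTypes X => a o.out := by
    rintro _ ⟨⟨A, hA⟩, hAf, rfl⟩
    obtain ⟨i, hi, rfl⟩ := exists_isometry_of_mem_copies hA
    choose j hj using fun x => hAf ⟨x, rfl⟩
    have hjiso : Isometry j := Isometry.of_dist_eq fun x y => by
      rw [← hf.dist_eq, hj, hj, hi.dist_eq]
    -- The copy inherits its type from `ρ`. Reparametrising by `e` replaces this ordering by the
    -- chosen representative without changing the copy as a set.
    let o : OrderTypes X := Quotient.mk _ ⟨pullback j ρ, pullback_mem_cLO hjiso hρ⟩
    obtain ⟨e, he⟩ := Quotient.exact (Quotient.out_eq o)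
    have hje : Isometry (j ∘ e) := hjiso.comp e.isometry
    have ho : o.out.1 = pullback (j ∘ e) ρ := funext₂ fun x y => propext (he x y)
    have hw : IsLabelling o.out.1 fun p : X × D => (h ∘ v) ((j ∘ e) p.1, p.2) := by
      rw [ho]
      exact hv'.comp_isometry hje
    refine ⟨o, ?_⟩
    set w : X × D → α := fun p => (h ∘ v) ((j ∘ e) p.1, p.2)
    have hfin : (Set.range w).Finite := Set.toFinite _
    have hcard : hfin.toFinset.card = q := by
      rw [← Set.ncard_eq_toFinset_card _ hfin]
      exact hq α _ w o.out.2 hw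
    have hVH : hfin.toFinset ⊆ H := by
      intro x hx
      obtain ⟨p, rfl⟩ := hfin.mem_toFinset.1 hx
      exact H.orderEmbOfFin_mem hH _
    have hleaf : Set.range (leaf w) = Set.range i := by
      have : leaf w = i ∘ e := funext fun x => hj (e x)
      rw [this, e.surjective.range_comp]
    have := congrFun (ha _ hVH hcard) o.out
    rw [hc o.out w _ hw hfin.coe_toFinset.symm, hleaf] at this
    simp only [χ', dif_pos hA] at this
    exact this.symm
  calc _ ≤ (Set.range fun o : OrderTypes X => a o.out).ncard := Set.ncard_le_ncard hsub
    _ ≤ Nat.card (OrderTypes X) := by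
      rw [← Set.image_univ, ← Set.ncard_univ]
      exact Set.ncard_image_le

theorem exists_not_arrows {S : Set ℝ} (hX : FinUltrametric S X inferInstance) :
    ∃ (Y : Type u) (_ : MetricSpace Y), FinUltrametric S Y inferInstance ∧
      ∀ (Z : Type u) [MetricSpace Z], FinUltrametric S Z inferInstance →
        ∀ l, Arrows X Y Z (Nat.card (OrderTypes X)) l → Nat.card (OrderTypes X) ≤ l := by
  obtain ⟨_, _, hXS⟩ := hX
  obtain ⟨D, hDX, hXD⟩ := exists_finset_dist X
  have hD : ∀ s ∈ D, 0 < s := fun s hs => by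
    obtain ⟨x, y, hxy, rfl⟩ := hDX s hs
    exact dist_pos.2 hxy
  have : Fact (∀ s ∈ D, 0 < s) := ⟨hD⟩
  refine ⟨Leaves D (ULift.{u} (Fin (Nat.card (X × D)))), inferInstance,
    Leaves.finUltrametric fun s hs => ?_, fun Z _ hZ l hl => ?_⟩
  · obtain ⟨x, y, hxy, rfl⟩ := hDX s hs
    exact hXS x y hxy
  obtain ⟨_, _, -⟩ := hZ
  obtain ⟨r, hr⟩ := cLO_nonempty (X := Z)
  choose i hi hiA using fun A : copies X Z => exists_isometry_of_mem_copies A.2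
  let type : copies X Z → OrderTypes X := fun A =>
    Quotient.mk _ ⟨pullback (i A) r, pullback_mem_cLO (hi A) hr⟩
  let e := Finite.equivFin (OrderTypes X)
  obtain ⟨B, hB, hBl⟩ := hl (e ∘ type)
  obtain ⟨j, hj, rfl⟩ := exists_isometry_of_mem_copies hB
  suffices h : (e ∘ type) '' {A : copies X Z | (A : Set Z) ⊆ Set.range j} = Set.univ by
    rwa [h, Set.ncard_univ, Nat.card_fin] at hBl
  rw [Set.eq_univ_iff_forall]
  intro a
  obtain ⟨g, hg, hgr⟩ := Leaves.exists_isometry_pullback_eq hXD (pullback_mem_cLO hj hr)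
    (e.symm a).out.2
  have hjg : Isometry (j ∘ g) := hj.comp hg
  let A : copies X Z := ⟨Set.range (j ∘ g), range_mem_copies hjg⟩
  refine ⟨A, Set.range_comp_subset_range g j, ?_⟩
  rw [Function.comp_apply, ← Equiv.eq_symm_apply, ← (e.symm a).out_eq]
  -- The chosen parametrisation `i A` and `j ∘ g` have the same range, so they differ by an isometry
  -- of `X`, which does not affect the order type.
  have hmem : ∀ x, ∃ y, j (g y) = i A x := fun x => by
    have : i A x ∈ Set.range (i A) := ⟨x, rfl⟩
    rwa [hiA A] at this
  choose σ hσ using hmem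
  have hσiso : Isometry σ := Isometry.of_dist_eq fun x y => by
    rw [← hjg.dist_eq, Function.comp_apply, Function.comp_apply, hσ, hσ, (hi A).dist_eq]
  refine Quotient.sound ⟨⟨Equiv.ofBijective σ (Finite.injective_iff_bijective.1 hσiso.injective),
    hσiso⟩, fun x y => ?_⟩
  change r (i A x) (i A y) ↔ (e.symm a).out.1 (σ x) (σ y)
  rw [← hgr, ← hσ, ← hσ]
  rfl

end Degree

end UltraRamsey

theorem theorem1 (S : Set ℝ) (hS : S ⊆ Set.Ioi 0) (X : Type u) [MetricSpace X]
    (hX : UltraRamsey.FinUltrametric S X inferInstance) :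
    ∃ t : ℕ,
      UltraRamsey.IsRamseyDegree (UltraRamsey.FinUltrametric S) X t ∧
      (t : ℚ) = (Nat.card (UltraRamsey.cLO X) : ℚ) / (Nat.card (X ≃ᵢ X) : ℚ) ∧
      t = Nat.card (UltraRamsey.OrderTypes X) := by
  have : Finite X := hX.1
  have : IsUltrametricDist X := hX.2.1
  have : Finite (X ≃ᵢ X) := Finite.of_injective _ IsometryEquiv.toEquiv_injective
  have hpos : 0 < Nat.card (UltraRamsey.OrderTypes X) := by
    obtain ⟨r, hr⟩ := UltraRamsey.cLO_nonempty (X := X)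
    have : Nonempty (UltraRamsey.OrderTypes X) := ⟨Quotient.mk _ ⟨r, hr⟩⟩
    exact Nat.card_pos
  refine ⟨Nat.card (UltraRamsey.OrderTypes X), ⟨⟨hpos, fun Y _ hY k hk => ?_⟩, ?_⟩, ?_, rfl⟩
  · exact UltraRamsey.exists_arrows hX Y hY hk
  · rintro l ⟨-, hl⟩
    obtain ⟨Y, _, hY, h⟩ := UltraRamsey.exists_not_arrows hX
    -- The number of colours is taken to be the number of order types.
    obtain ⟨Z, _, hZ, hZl⟩ := hl Y _ hY _ hpos
    exact h Z hZ l hZl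
  · rw [eq_div_iff (by exact_mod_cast Nat.card_pos.ne'), UltraRamsey.card_cLO_eq, Nat.cast_mul]
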